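/- Semigroups are nonempty. A \emph{pseudovariety of semigroups} is a class of finite semigroups closed under taking subsemigroups, homomorphic images and finitary direct products. A semigroup $S$ is \emph{equidivisible} if for all $u,v,x,y\in S$ with $uv=xy$, either $u=x$ and $v=y$, or there is $t\in S$ such that $ut=x$ and $v=ty$, or there is $t\in S$ such that $xt=u$ and $y=tv$. A pseudovariety $\mathsf V$ is \emph{equidivisible} if every finitely generated free pro-$\mathsf V$ semigroup is equidivisible, where the free pro-$\mathsf V$ semigroup over a finite nonempty set $A$ is the projective limit of all $A$-generated semigroups of $\mathsf V$, that is, of the quotients of the free semigroup $A^+$ that belong to $\mathsf V$. Let $\mathsf{LG}$ be the class of all finite semigroups $S$ whose local monoids $eSe$ ($e\in S$ idempotent) are groups, $\mathsf{LI}$ the class of all finite semigroups whose local monoids are trivial, and $\mathsf{CS}$ the class of all finite completely simple semigroups. \textbf{Theorem.} Let $\mathsf V$ be a pseudovariety of semigroups contained in $\mathsf{LG}$. Then $\mathsf V$ is equidivisible if and only if $\mathsf V\subseteq\mathsf{CS}$ or $\mathsf{LI}\subseteq\mathsf V$. -/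

import Mathlib

universe u

/-- A semigroup `S` is equidivisible if `u * v = x * y` implies that `u = x` and `v = y`, or that
there is `t` with `u * t = x` and `v = t * y`, or that there is `t` with `x * t = u` and
`y = t * v`. -/
def IsEquidivisible (S : Type u) [Semigroup S] : Prop :=
  ∀ u v x y : S, u * v = x * y →
    (u = x ∧ v = y) ∨ (∃ t : S, u * t = x ∧ v = t * y) ∨ (∃ t : S, x * t = u ∧ y = t * v)

/-- A pseudovariety of semigroups: a class of finite (nonempty) semigroups that is closed under
taking (nonempty) subsemigroups, homomorphic images and finitary direct products. The empty
product is allowed, so that the one-element semigroups belong to every pseudovariety. -/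
structure Pseudovariety where
  /-- The semigroup `S` belongs to the class. -/
  Mem : (S : Type u) → [Semigroup S] → Prop
  finite_of_mem : ∀ (S : Type u) [Semigroup S], Mem S → Finite S
  nonempty_of_mem : ∀ (S : Type u) [Semigroup S], Mem S → Nonempty S
  subsemigroup_mem : ∀ (S : Type u) [Semigroup S] (T : Subsemigroup S),
    Nonempty T → Mem S → Mem T
  image_mem : ∀ (S T : Type u) [Semigroup S] [Semigroup T] (f : S →ₙ* T),
    Function.Surjective f → Mem S → Mem T
  pi_mem : ∀ (ι : Type) [Finite ι] (S : ι → Type u) [∀ i, Semigroup (S i)],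
    (∀ i, Mem (S i)) → Mem (∀ i, S i)

/-- The class `LG` of the finite local groups: the finite semigroups all of whose local monoids
`eSe`, with `e` idempotent, are groups. (`Subsemigroup.corner e` is `eSe`; its identity element
is `e`.) -/
def IsFiniteLocalGroup (S : Type u) [Semigroup S] : Prop :=
  Finite S ∧ Nonempty S ∧ ∀ e : S, IsIdempotentElem e →
    ∀ x ∈ Subsemigroup.corner e, ∃ y ∈ Subsemigroup.corner e, x * y = e ∧ y * x = e

/-- The class `LI` of the finite locally trivial semigroups: the finite semigroups all of whose
local monoids `eSe`, with `e` idempotent, are trivial. -/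
def IsFiniteLocallyTrivial (S : Type u) [Semigroup S] : Prop :=
  Finite S ∧ Nonempty S ∧ ∀ e : S, IsIdempotentElem e → ∀ x ∈ Subsemigroup.corner e, x = e

/-- A semigroup is simple if it is its only nonempty two-sided ideal. -/
def SemigroupIsSimple (S : Type u) [Semigroup S] : Prop :=
  Nonempty S ∧ ∀ I : Set S, I.Nonempty → (∀ s, ∀ a ∈ I, s * a ∈ I ∧ a * s ∈ I) → I = Set.univ

/-- An idempotent `e` is primitive if it is minimal for the natural order of idempotents, where
`f ≤ e` means `e * f = f` and `f * e = f`. -/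
def IsPrimitiveIdempotent {S : Type u} [Semigroup S] (e : S) : Prop :=
  IsIdempotentElem e ∧ ∀ f : S, IsIdempotentElem f → e * f = f → f * e = f → f = e

/-- The class `CS` of the finite completely simple semigroups: the finite simple semigroups that
have a primitive idempotent. -/
def IsFiniteCompletelySimple (S : Type u) [Semigroup S] : Prop :=
  Finite S ∧ SemigroupIsSimple S ∧ ∃ e : S, IsPrimitiveIdempotent e

/-- The canonical homomorphism `M ⧸ c → M ⧸ d` for congruences `c ≤ d` on a semigroup `M`. -/
def conTransition {M : Type u} [Semigroup M] {c d : Con M} (h : c ≤ d) :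
    c.Quotient →ₙ* d.Quotient where
  toFun := Quotient.map' id fun _ _ hxy => h hxy
  map_mul' := by
    rintro ⟨x⟩ ⟨y⟩
    rfl

namespace Pseudovariety

/-- The congruences on the free semigroup `A⁺` whose quotient belongs to `V`. The quotients by
them are, up to isomorphism, the `A`-generated semigroups of `V`. -/
def FreeCon (V : Pseudovariety.{u}) (A : Type u) : Type u :=
  {c : Con (FreeSemigroup A) // V.Mem c.Quotient}

/-- The free pro-`V` semigroup over a finite set `A`: the projective limit of all `A`-generated
semigroups of `V`, i.e. the semigroup of all families `(x_c)`, with `x_c ∈ A⁺ ⧸ c`, that are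
compatible with the canonical homomorphisms `A⁺ ⧸ c → A⁺ ⧸ d` for `c ≤ d`. -/
def freePro (V : Pseudovariety.{u}) (A : Type u) :
    Subsemigroup (∀ c : V.FreeCon A, c.1.Quotient) where
  carrier := {x | ∀ (c d : V.FreeCon A) (h : c.1 ≤ d.1), conTransition h (x c) = x d}
  mul_mem' := by
    intro x y hx hy c d h
    rw [Pi.mul_apply, Pi.mul_apply, map_mul, hx c d h, hy c d h]

/-- A pseudovariety `V` is equidivisible if every finitely generated free pro-`V` semigroup is
equidivisible. -/
def Equidivisible (V : Pseudovariety.{u}) : Prop :=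
  ∀ (A : Type u) [Finite A] [Nonempty A], IsEquidivisible (V.freePro A)

end Pseudovariety

/-! In a finite local group every idempotent lies in the minimal ideal, so by pigeonhole on prefixes
every long enough word takes its value there (`exists_forall_inMinimalIdeal`). Inside the minimal
ideal `u * v = x * y` always yields `t` (`InMinimalIdeal.exists_of_mul_eq_mul`), and compactness
carries such factorizations from the finite quotients to the free pro-`V` semigroup. This settles
the case of CS.

If `V` contains LI, it contains the quotients of `A⁺` that record a prefix and a suffix of bounded
length. An equality of products then compares short factors as words, while long factors have values
in the minimal ideal (`exists_of_map_mul_eq`).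

Conversely, a member of `V` outside CS has an element that is not a product
(`exists_forall_ne_mul`), so some quotient in `V` separates letters from all other words.
Equidivisibility then strips letters one at a time: by induction `V` sees prefixes and suffixes of
every length. These determine the value of a word in a locally trivial semigroup, so LI is contained
in `V`. -/

section MinimalIdeal

/-! ### The minimal ideal of a finite semigroup. -/

variable {S : Type u} [Semigroup S]

/-- `k` belongs to the minimal ideal of `S`. -/
def InMinimalIdeal (k : S) : Prop := ∀ s, ∃ a b, k = a * s * b

theorem InMinimalIdeal.mul_right {k : S} (hk : InMinimalIdeal k) (s : S) :
    InMinimalIdeal (k * s) := by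
  intro x
  obtain ⟨a, b, h⟩ := hk x
  exact ⟨a, b * s, by rw [h, mul_assoc (a * x)]⟩

theorem InMinimalIdeal.mul_left {k : S} (hk : InMinimalIdeal k) (s : S) :
    InMinimalIdeal (s * k) := by
  intro x
  obtain ⟨a, b, h⟩ := hk x
  exact ⟨s * a, b, by rw [h]; simp only [mul_assoc]⟩

/-- A multiplicatively closed nonempty subset of a finite semigroup contains an idempotent. -/
theorem exists_idempotent_mem [Finite S] (s : Set S) (hs : s.Nonempty)
    (hmul : ∀ x ∈ s, ∀ y ∈ s, x * y ∈ s) : ∃ e ∈ s, e * e = e := by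
  let : TopologicalSpace S := ⊥
  have : DiscreteTopology S := ⟨rfl⟩
  exact exists_idempotent_in_compact_subsemigroup (fun _ => continuous_of_discreteTopology) s hs
    s.toFinite.isCompact hmul

/-- Stability of finite semigroups: an idempotent `e = t * y` with `k = b * k * e` fixes `k` on the
right. -/
theorem exists_eq_mul_mul_of_eq_right [Finite S] {k a t : S} (h : k = a * k * t) :
    ∃ z, k = k * t * z := by
  obtain ⟨e, ⟨⟨b, hb⟩, y, hy⟩, he⟩ := exists_idempotent_mem
    {z : S | (∃ b, k = b * k * z) ∧ ∃ y, z = t * y}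
    -- The square is needed because `t` itself need not be a multiple of `t`: there is no identity.
    ⟨t * t, ⟨a * a, by
      calc k = a * k * t := h
        _ = a * (a * k * t) * t := congrArg (fun x => a * x * t) h
        _ = _ := by simp only [mul_assoc]⟩, t, rfl⟩ (by
      rintro x ⟨⟨b, hb⟩, y, rfl⟩ x' ⟨⟨b', hb'⟩, -⟩
      refine ⟨⟨b' * b, ?_⟩, y * x', mul_assoc _ _ _⟩
      calc k = b' * k * x' := hb'
        _ = b' * (b * k * (t * y)) * x' := by rw [← hb]
        _ = _ := by simp only [mul_assoc])
  refine ⟨y, ?_⟩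
  rw [mul_assoc, ← hy]
  calc k = b * k * e := hb
    _ = b * k * e * e := by rw [mul_assoc _ e e, he]
    _ = k * e := by rw [← hb]

theorem exists_eq_mul_mul_of_eq_left [Finite S] {k a t : S} (h : k = t * k * a) :
    ∃ z, k = z * t * k := by
  obtain ⟨e, ⟨⟨b, hb⟩, y, hy⟩, he⟩ := exists_idempotent_mem
    {z : S | (∃ b, k = z * k * b) ∧ ∃ y, z = y * t}
    ⟨t * t, ⟨a * a, by
      calc k = t * k * a := h
        _ = t * (t * k * a) * a := congrArg (fun x => t * x * a) h
        _ = _ := by simp only [mul_assoc]⟩, t, rfl⟩ (by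
      rintro x ⟨⟨b, hb⟩, -⟩ x' ⟨⟨b', hb'⟩, y, rfl⟩
      refine ⟨⟨b' * b, ?_⟩, x * y, (mul_assoc _ _ _).symm⟩
      calc k = x * k * b := hb
        _ = x * (y * t * k * b') * b := by rw [← hb']
        _ = _ := by simp only [mul_assoc])
  refine ⟨y, ?_⟩
  rw [← hy]
  calc k = e * k * b := hb
    _ = e * (e * k * b) := by simp only [← mul_assoc, he]
    _ = e * k := by rw [← hb]

theorem InMinimalIdeal.exists_eq_mul_right [Finite S] {k : S} (hk : InMinimalIdeal k) (s : S) :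
    ∃ z, k = k * s * z := by
  obtain ⟨a, b, h⟩ := hk (k * s)
  obtain ⟨z, hz⟩ := exists_eq_mul_mul_of_eq_right (k := k) (a := a) (t := s * b)
    (by simpa only [mul_assoc] using h)
  exact ⟨b * z, by simpa only [mul_assoc] using hz⟩

theorem InMinimalIdeal.exists_eq_mul_left [Finite S] {k : S} (hk : InMinimalIdeal k) (s : S) :
    ∃ z, k = z * s * k := by
  obtain ⟨a, b, h⟩ := hk (s * k)
  obtain ⟨z, hz⟩ := exists_eq_mul_mul_of_eq_left (k := k) (a := b) (t := a * s)
    (by simpa only [mul_assoc] using h)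
  exact ⟨z * a, by simpa only [mul_assoc] using hz⟩

theorem InMinimalIdeal.exists_idempotent_right [Finite S] {k : S} (hk : InMinimalIdeal k) :
    ∃ g, k * (g * k) = k ∧ g * k * (g * k) = g * k := by
  obtain ⟨w, hw⟩ := hk.exists_eq_mul_left (k * k)
  obtain ⟨e, ⟨⟨b, hb⟩, y, hy⟩, he⟩ := exists_idempotent_mem
    {z : S | (∃ b, k = b * k * z) ∧ ∃ y, z = y * k}
    ⟨k * k, ⟨w, by simpa only [mul_assoc] using hw⟩, k, rfl⟩ (by
      rintro x ⟨⟨b, hb⟩, -⟩ x' ⟨⟨b', hb'⟩, y, rfl⟩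
      refine ⟨⟨b' * b, ?_⟩, x * y, (mul_assoc _ _ _).symm⟩
      calc k = b' * k * (y * k) := hb'
        _ = b' * (b * k * x) * (y * k) := by rw [← hb]
        _ = _ := by simp only [mul_assoc])
  refine ⟨y, ?_, by rw [← hy, he]⟩
  rw [← hy]
  calc k * e = b * k * e * e := by rw [← hb]
    _ = k := by rw [mul_assoc _ e e, he, ← hb]

/-- Equidivisibility inside the minimal ideal of a finite semigroup. -/
theorem InMinimalIdeal.exists_of_mul_eq_mul [Finite S] {u v x y : S} (hv : InMinimalIdeal v)
    (hx : InMinimalIdeal x) (h : u * v = x * y) : ∃ t, u * t = x ∧ v = t * y := by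
  obtain ⟨g, hg, -⟩ := (hv.mul_left u).exists_idempotent_right
  obtain ⟨z, hz⟩ := hx.exists_eq_mul_right y
  obtain ⟨w, hw⟩ := hv.exists_eq_mul_left u
  -- In a group `t` would be `v * (u * v)⁻¹ * x`; `g` stands in for the inverse of `u * v`.
  refine ⟨v * g * x, ?_, ?_⟩
  · calc u * (v * g * x) = u * v * g * x := by simp only [mul_assoc]
      _ = u * v * g * (x * y * z) := by rw [← hz]
      _ = u * v * (g * (u * v)) * z := by rw [← h]; simp only [mul_assoc]
      _ = x := by rw [hg, h, ← hz]
  · calc v = w * u * v := hw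
      _ = w * (u * v * (g * (u * v))) := by rw [hg, mul_assoc]
      _ = w * u * v * g * (x * y) := by rw [← h]; simp only [mul_assoc]
      _ = v * g * x * y := by rw [← hw]; simp only [mul_assoc]

theorem SemigroupIsSimple.inMinimalIdeal (hS : SemigroupIsSimple S) (k : S) :
    InMinimalIdeal k := by
  intro s
  have h : {k : S | ∃ a b, k = a * s * b} = Set.univ := by
    refine hS.2 _ ⟨s * s * s, s, s, rfl⟩ ?_
    rintro x _ ⟨a, b, rfl⟩
    exact ⟨⟨x * a, b, by simp only [mul_assoc]⟩, a, b * x, by simp only [mul_assoc]⟩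
  exact Set.eq_univ_iff_forall.1 h k

theorem isFiniteCompletelySimple_of_forall_inMinimalIdeal [Finite S] [hne : Nonempty S]
    (h : ∀ k : S, InMinimalIdeal k) : IsFiniteCompletelySimple S := by
  refine ⟨inferInstance, ⟨hne, fun I ⟨i, hi⟩ hI => Set.eq_univ_of_forall fun x => ?_⟩, ?_⟩
  · obtain ⟨a, b, rfl⟩ := h x i
    exact (hI b _ (hI a _ hi).1).2
  · obtain ⟨e, -, he⟩ := exists_idempotent_mem (Set.univ : Set S) Set.univ_nonempty
      (fun _ _ _ _ => Set.mem_univ _)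
    refine ⟨e, he, fun f hf hef hfe => ?_⟩
    obtain ⟨z, hz⟩ := (h e).exists_eq_mul_right f
    rw [hef] at hz
    rw [← hfe, hz, ← mul_assoc, hf.eq]

theorem IsFiniteLocallyTrivial.isFiniteLocalGroup (hS : IsFiniteLocallyTrivial S) :
    IsFiniteLocalGroup S :=
  ⟨hS.1, hS.2.1, fun e he x hx => ⟨x, hx, by simp [hS.2.2 e he x hx, he.eq]⟩⟩

theorem mul_mul_mem_corner (e x : S) :
    e * x * e ∈ Subsemigroup.corner e :=
  ⟨x, rfl⟩

theorem IsFiniteLocalGroup.inMinimalIdeal_of_idempotent (hS : IsFiniteLocalGroup S) {e : S}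
    (he : e * e = e) : InMinimalIdeal e := by
  intro s
  obtain ⟨y, -, hy, -⟩ := hS.2.2 e he (e * s * e) (mul_mul_mem_corner _ s)
  exact ⟨e, e * y, by rw [← mul_assoc, hy]⟩

/-- The right stabilizer of `p` is a subsemigroup, so it contains an idempotent, and that lies in
the minimal ideal. -/
theorem IsFiniteLocalGroup.inMinimalIdeal_of_mul_eq (hS : IsFiniteLocalGroup S) {p t : S}
    (h : p * t = p) : InMinimalIdeal p := by
  have := hS.1
  obtain ⟨e, hpe, he⟩ := exists_idempotent_mem {z : S | p * z = p} ⟨t, h⟩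
    (fun x (hx : p * x = p) y (hy : p * y = p) => by
      rw [Set.mem_ofPred_eq, ← mul_assoc, hx, hy])
  rw [Set.mem_ofPred_eq] at hpe
  exact hpe ▸ (hS.inMinimalIdeal_of_idempotent he).mul_left p

/-- With the next lemma: the minimal ideal is a rectangular band. -/
theorem IsFiniteLocallyTrivial.mul_self (hS : IsFiniteLocallyTrivial S) {k : S}
    (hk : InMinimalIdeal k) : k * k = k := by
  have := hS.1
  obtain ⟨g, hg, he⟩ := hk.exists_idempotent_right
  have h := hS.2.2 _ he _ (mul_mul_mem_corner _ k)
  calc k * k = k * (g * k) * (k * (g * k)) := by rw [hg]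
    _ = k * (g * k * k * (g * k)) := by simp only [mul_assoc]
    _ = k := by rw [h, hg]

theorem IsFiniteLocallyTrivial.mul_mul_self (hS : IsFiniteLocallyTrivial S) {k : S}
    (hk : InMinimalIdeal k) (x : S) : k * x * k = k :=
  hS.2.2 k (hS.mul_self hk) _ (mul_mul_mem_corner _ x)

end MinimalIdeal

/-! ### Words and their values in finite local groups. -/

namespace FreeSemigroup

variable {A : Type u}

/-- The list of letters of a word. -/
def toList (w : FreeSemigroup A) : List A := w.head :: w.tail

@[simp] theorem toList_mul (w w' : FreeSemigroup A) :
    (w * w').toList = w.toList ++ w'.toList := rfl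

@[simp] theorem toList_of (a : A) : (of a).toList = [a] := rfl

theorem toList_ne_nil (w : FreeSemigroup A) : w.toList ≠ [] := List.cons_ne_nil _ _

theorem toList_length_pos (w : FreeSemigroup A) : 0 < w.toList.length := by simp [toList]

theorem toList_injective : Function.Injective (toList (A := A)) := by
  rintro ⟨a, l⟩ ⟨b, m⟩ h
  simpa [toList] using h

theorem exists_toList_eq {l : List A} (h : l ≠ []) : ∃ w : FreeSemigroup A, w.toList = l := by
  cases l with
  | nil => exact absurd rfl h
  | cons a l => exact ⟨⟨a, l⟩, rfl⟩

theorem eq_or_exists_eq_mul_of_toList_eq {w p : FreeSemigroup A} {l : List A}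
    (h : w.toList = p.toList ++ l) : w = p ∨ ∃ r : FreeSemigroup A, r.toList = l ∧ w = p * r := by
  by_cases hl : l = []
  · exact Or.inl (toList_injective (by simpa [hl] using h))
  · obtain ⟨r, rfl⟩ := exists_toList_eq hl
    exact Or.inr ⟨r, rfl, toList_injective (by simpa using h)⟩

theorem eq_or_exists_eq_mul_of_toList_eq' {w p : FreeSemigroup A} {l : List A}
    (h : w.toList = l ++ p.toList) : w = p ∨ ∃ r : FreeSemigroup A, r.toList = l ∧ w = r * p := by
  by_cases hl : l = []
  · exact Or.inl (toList_injective (by simpa [hl] using h))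
  · obtain ⟨r, rfl⟩ := exists_toList_eq hl
    exact Or.inr ⟨r, rfl, toList_injective (by simpa using h)⟩

/-- In a finite local group, the values of all sufficiently long words lie in the minimal
ideal. -/
theorem exists_forall_inMinimalIdeal {S : Type u} [Semigroup S] (hS : IsFiniteLocalGroup S)
    (φ : FreeSemigroup A →ₙ* S) :
    ∃ N : ℕ, 0 < N ∧ ∀ w : FreeSemigroup A, N ≤ w.toList.length → InMinimalIdeal (φ w) := by
  have := hS.1
  refine ⟨Nat.card S + 1, Nat.succ_pos _, fun w hw => ?_⟩
  have hpre : ∀ i : Fin (Nat.card S + 1), ∃ p : FreeSemigroup A, p.toList = w.toList.take (i + 1) :=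
    fun i => exists_toList_eq (by simp [toList_ne_nil])
  choose p hp using hpre
  -- Pigeonhole on the prefixes of lengths `1, …, |S| + 1`; a repeated value is one fixed by a right
  -- factor.
  obtain ⟨i, j, hij, he⟩ : ∃ i j, i < j ∧ φ (p i) = φ (p j) := by
    by_contra! hcon
    have hinj : Function.Injective (fun i => φ (p i)) := fun i j h => by
      rcases lt_trichotomy i j with hlt | heq | hlt
      · exact absurd h (hcon i j hlt)
      · exact heq
      · exact absurd h.symm (hcon j i hlt)
    simpa using Nat.card_le_card_of_injective _ hinj
  have hlt : (i : ℕ) < j := hij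
  have hmin : InMinimalIdeal (φ (p i)) := by
    have hji : (p j).toList = (p i).toList ++ (w.toList.take (j + 1)).drop (i + 1) := by
      rw [hp, hp]
      conv_lhs => rw [← List.take_append_drop (i + 1 : ℕ) (w.toList.take (j + 1))]
      rw [List.take_take, min_eq_left (by omega)]
    rcases eq_or_exists_eq_mul_of_toList_eq hji with h | ⟨r, -, h⟩
    · have h1 := congrArg (fun q => q.toList.length) h
      simp only [hp, List.length_take] at h1
      have := j.2
      omega
    · rw [h, map_mul] at he
      exact hS.inMinimalIdeal_of_mul_eq he.symm
  have hwi : w.toList = (p i).toList ++ w.toList.drop (i + 1) := by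
    rw [hp, List.take_append_drop]
  rcases eq_or_exists_eq_mul_of_toList_eq hwi with h | ⟨r, -, h⟩
  · rwa [h]
  · rw [h, map_mul]
    exact hmin.mul_right _

end FreeSemigroup

/-- The homomorphism on the quotient induced by a homomorphism that identifies congruent
elements. -/
def conLift {M P : Type u} [Semigroup M] [Semigroup P] (c : Con M) (f : M →ₙ* P)
    (h : ∀ x y, c x y → f x = f y) : c.Quotient →ₙ* P where
  toFun := Quotient.lift f h
  map_mul' := by
    rintro ⟨x⟩ ⟨y⟩
    exact map_mul f x y

/-- The canonical homomorphism onto a quotient. -/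
def conMk {M : Type u} [Semigroup M] (c : Con M) : M →ₙ* c.Quotient where
  toFun x := x
  map_mul' _ _ := rfl

/-! ### Finite quotients, compactness and the completely simple case. -/

namespace Pseudovariety

variable (V : Pseudovariety.{u}) {A : Type u}

variable {V} in
theorem Mem.of_injective {S T : Type u} [Semigroup S] [Semigroup T] [Nonempty S] (f : S →ₙ* T)
    (hf : Function.Injective f) (hT : V.Mem T) : V.Mem S := by
  have hr : V.Mem f.srange := V.subsemigroup_mem T _
    ⟨f (Classical.arbitrary S), Classical.arbitrary S, rfl⟩ hT
  have hb : Function.Bijective f.srangeRestrict :=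
    ⟨fun x y h => hf (congrArg Subtype.val h), f.srangeRestrict_surjective⟩
  exact V.image_mem _ _ (MulEquiv.ofBijective f.srangeRestrict hb).symm.toMulHom
    (MulEquiv.ofBijective f.srangeRestrict hb).symm.surjective hr

theorem mem_quotient_iInf [Nonempty A] {ι : Type} [Finite ι] (c : ι → V.FreeCon A) :
    V.Mem (⨅ i, (c i).1 : Con (FreeSemigroup A)).Quotient := by
  have : Nonempty (⨅ i, (c i).1 : Con (FreeSemigroup A)).Quotient :=
    ⟨((FreeSemigroup.of (Classical.arbitrary A) : FreeSemigroup A) : Con.Quotient _)⟩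
  let f : (⨅ i, (c i).1 : Con (FreeSemigroup A)).Quotient →ₙ* ∀ i, (c i).1.Quotient :=
    { toFun := fun x i => conTransition (iInf_le _ i) x
      map_mul' := fun x y => funext fun i => map_mul _ _ _ }
  refine Mem.of_injective f ?_ (V.pi_mem ι _ fun i => (c i).2)
  rintro ⟨x⟩ ⟨y⟩ h
  refine (Con.eq _).2 ?_
  rintro _ ⟨i, rfl⟩
  exact (Con.eq _).1 (congrFun h i)

theorem exists_freeCon_le [Nonempty A] {ι : Type*} [Finite ι] (c : ι → V.FreeCon A) :
    ∃ d : V.FreeCon A, ∀ i, d.1 ≤ (c i).1 := by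
  -- Products in `V` are indexed by `Type`, whereas `ι` may be an alphabet in a higher universe.
  obtain ⟨n, ⟨e⟩⟩ := Finite.exists_equiv_fin ι
  refine ⟨⟨_, V.mem_quotient_iInf fun i => c (e.symm i)⟩, fun i => ?_⟩
  simpa using iInf_le (fun i => (c (e.symm i)).1) (e i)

theorem exists_freeCon_le₂ [Nonempty A] (c d : V.FreeCon A) :
    ∃ e : V.FreeCon A, e.1 ≤ c.1 ∧ e.1 ≤ d.1 := by
  obtain ⟨e, he⟩ := V.exists_freeCon_le fun b : Bool => cond b c d
  exact ⟨e, he true, he false⟩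

/-- The kernel of a homomorphism into a member of `V`. -/
def kerFreeCon [Nonempty A] {S : Type u} [Semigroup S] (hS : V.Mem S)
    (f : FreeSemigroup A →ₙ* S) : V.FreeCon A :=
  ⟨Con.ker f, by
    have : Nonempty (Con.ker f).Quotient :=
      ⟨((FreeSemigroup.of (Classical.arbitrary A) : FreeSemigroup A) : Con.Quotient _)⟩
    refine Mem.of_injective (conLift (Con.ker f) f fun _ _ h => h) ?_ hS
    rintro ⟨x⟩ ⟨y⟩ h
    exact (Con.eq _).2 h⟩

/-- Compatible nonempty relations on the finite quotients are satisfied by elements of the free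
pro-`V` semigroup. -/
theorem exists_freePro_forall [Nonempty A] {ι : Type} [Finite ι]
    (R : ∀ c : V.FreeCon A, (ι → c.1.Quotient) → Prop) (hne : ∀ c, ∃ f, R c f)
    (hR : ∀ (c d : V.FreeCon A) (h : c.1 ≤ d.1) (f), R c f → R d fun i => conTransition h (f i)) :
    ∃ x : ι → V.freePro A, ∀ c, R c fun i => (x i).1 c := by
  let : Preorder (V.FreeCon A) := Preorder.lift Subtype.val
  have : IsCodirectedOrder (V.FreeCon A) := ⟨fun c d => V.exists_freeCon_le₂ c d⟩
  let F : CategoryTheory.Functor (V.FreeCon A) (Type u) :=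
    { obj := fun c => {f : ι → c.1.Quotient // R c f}
      map := fun {c d} h => TypeCat.ofHom
        fun f : {f : ι → c.1.Quotient // R c f} =>
          (⟨fun i => conTransition h.le (f.1 i), hR c d h.le _ f.2⟩ :
            {f : ι → d.1.Quotient // R d f})
      map_id := fun c => by
        ext f i
        obtain ⟨w, hw⟩ := Quotient.exists_rep (f.1 i)
        exact (congrArg (conTransition le_rfl) hw.symm).trans hw
      map_comp := fun {c d e} h h' => by
        ext f i
        obtain ⟨w, hw⟩ := Quotient.exists_rep (f.1 i)
        exact (congrArg (conTransition (h.le.trans h'.le)) hw.symm).trans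
          (congrArg (fun q => conTransition h'.le (conTransition h.le q)) hw) }
  have : ∀ c, Finite (F.obj c) := fun c => by
    have := V.finite_of_mem _ c.2
    exact inferInstanceAs (Finite {f : ι → c.1.Quotient // R c f})
  have : ∀ c, Nonempty (F.obj c) := fun c => by
    obtain ⟨f, hf⟩ := hne c
    exact ⟨⟨f, hf⟩⟩
  obtain ⟨s, hs⟩ := nonempty_sections_of_finite_cofiltered_system F
  refine ⟨fun i => ⟨fun c => (s c).1 i, fun c d h => ?_⟩, fun c => (s c).2⟩
  exact congrFun (congrArg Subtype.val (hs (CategoryTheory.homOfLE h))) i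

/-- A free pro-`V` semigroup is equidivisible if the alternatives in the definition hold in every
finite quotient. -/
theorem isEquidivisible_freePro [Nonempty A]
    (H : ∀ (c : V.FreeCon A) (u v x y : V.freePro A), u * v = x * y →
      (u.1 c = x.1 c ∧ v.1 c = y.1 c) ∨
      (∃ t : c.1.Quotient, u.1 c * t = x.1 c ∧ v.1 c = t * y.1 c) ∨
      (∃ t : c.1.Quotient, x.1 c * t = u.1 c ∧ y.1 c = t * v.1 c)) :
    IsEquidivisible (V.freePro A) := by
  intro u v x y h
  have lift : ∀ u v x y : V.freePro A,
      (∀ c, ∃ t : c.1.Quotient, u.1 c * t = x.1 c ∧ v.1 c = t * y.1 c) →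
      ∃ t, u * t = x ∧ v = t * y := by
    intro u v x y h
    obtain ⟨t, ht⟩ := V.exists_freePro_forall (ι := Unit)
      (fun c t => u.1 c * t () = x.1 c ∧ v.1 c = t () * y.1 c)
      (fun c => by obtain ⟨t, ht⟩ := h c; exact ⟨fun _ => t, ht⟩)
      (fun c d hcd t ⟨h1, h2⟩ => by
        rw [← u.2 c d hcd, ← v.2 c d hcd, ← x.2 c d hcd, ← y.2 c d hcd, h2, ← h1]
        simp only [map_mul, and_self])
    exact ⟨t (), Subtype.ext (funext fun c => (ht c).1), Subtype.ext (funext fun c => (ht c).2)⟩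
  -- The alternative may vary with `c`. But each one passes to coarser quotients, so if each fails
  -- somewhere, all three fail at a common refinement.
  by_contra hcon
  rw [not_or, not_or] at hcon
  obtain ⟨h1, h2, h3⟩ := hcon
  obtain ⟨c₁, hc₁⟩ : ∃ c, ¬ (u.1 c = x.1 c ∧ v.1 c = y.1 c) := by
    by_contra! hall
    exact h1 ⟨Subtype.ext (funext fun c => (hall c).1), Subtype.ext (funext fun c => (hall c).2)⟩
  obtain ⟨c₂, hc₂⟩ := not_forall.1 (mt (lift u v x y) h2)
  obtain ⟨c₃, hc₃⟩ := not_forall.1 (mt (lift x y u v) h3)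
  obtain ⟨d, hd₁, hd₂⟩ := V.exists_freeCon_le₂ c₁ c₂
  obtain ⟨e, hed, he₃⟩ := V.exists_freeCon_le₂ d c₃
  rcases H e u v x y h with ⟨h1, h2⟩ | ⟨t, h1, h2⟩ | ⟨t, h1, h2⟩
  · refine hc₁ ?_
    have hle := hed.trans hd₁
    rw [← u.2 e _ hle, ← v.2 e _ hle, ← x.2 e _ hle, ← y.2 e _ hle, h1, h2]
    exact ⟨rfl, rfl⟩
  · refine hc₂ ⟨conTransition (hed.trans hd₂) t, ?_⟩
    have hle := hed.trans hd₂
    rw [← u.2 e _ hle, ← v.2 e _ hle, ← x.2 e _ hle, ← y.2 e _ hle, ← h1, h2]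
    simp only [map_mul, and_self]
  · refine hc₃ ⟨conTransition he₃ t, ?_⟩
    rw [← u.2 e _ he₃, ← v.2 e _ he₃, ← x.2 e _ he₃, ← y.2 e _ he₃, ← h1, h2]
    simp only [map_mul, and_self]

/-- A pseudovariety of completely simple semigroups is equidivisible. -/
theorem equidivisible_of_completelySimple
    (hV : ∀ (S : Type u) [Semigroup S], V.Mem S → IsFiniteCompletelySimple S) :
    V.Equidivisible := by
  intro A _ _
  refine V.isEquidivisible_freePro fun c u v x y h => Or.inr (Or.inl ?_)
  have hc := hV _ c.2
  have := hc.1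
  exact (hc.2.1.inMinimalIdeal (v.1 c)).exists_of_mul_eq_mul (hc.2.1.inMinimalIdeal (x.1 c))
    (congrFun (congrArg Subtype.val h) c)

end Pseudovariety

/-! ### Prefix and suffix congruences; sufficiency of containing LI. -/

namespace FreeSemigroup

variable {A : Type u}

theorem take_append_take (M : ℕ) (l l' : List A) :
    (l.take M ++ l'.take M).take M = (l ++ l').take M := by
  rw [List.take_append, List.take_append, List.take_take, List.take_take, List.length_take,
    min_self]
  congr 2
  omega

/-- The congruence identifying words with the same prefix of length `M`. -/
def prefixCon (A : Type u) (M : ℕ) : Con (FreeSemigroup A) where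
  r w w' := w.toList.take M = w'.toList.take M
  iseqv := ⟨fun _ => rfl, Eq.symm, Eq.trans⟩
  mul' {w x y z} h h' := by
    change w.toList.take M = x.toList.take M at h
    change y.toList.take M = z.toList.take M at h'
    rw [toList_mul, toList_mul, ← take_append_take, h, h', take_append_take]

/-- The congruence identifying words with the same suffix of length `M`. -/
def suffixCon (A : Type u) (M : ℕ) : Con (FreeSemigroup A) where
  r w w' := w.toList.reverse.take M = w'.toList.reverse.take M
  iseqv := ⟨fun _ => rfl, Eq.symm, Eq.trans⟩
  mul' {w x y z} h h' := by
    change w.toList.reverse.take M = x.toList.reverse.take M at h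
    change y.toList.reverse.take M = z.toList.reverse.take M at h'
    rw [toList_mul, toList_mul, List.reverse_append, List.reverse_append, ← take_append_take, h, h',
      take_append_take]

theorem prefixCon_iff {M : ℕ} {w w' : FreeSemigroup A} :
    prefixCon A M w w' ↔ w.toList.take M = w'.toList.take M := Iff.rfl

theorem suffixCon_iff {M : ℕ} {w w' : FreeSemigroup A} :
    suffixCon A M w w' ↔ w.toList.reverse.take M = w'.toList.reverse.take M := Iff.rfl

theorem eq_of_take_eq {M : ℕ} {l l' : List A} (h : l.take M = l'.take M) (hl : l.length < M) :
    l = l' := by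
  have h1 := congrArg List.length h
  rw [List.length_take, List.length_take] at h1
  rwa [List.take_of_length_le hl.le, List.take_of_length_le (by omega)] at h

theorem exists_eq_append_of_take_eq {M : ℕ} {u v x y : List A}
    (h : (u ++ v).take M = (x ++ y).take M) (hu : u.length ≤ M) (hux : u.length ≤ x.length) :
    ∃ t, x = u ++ t ∧ v.take (M - u.length) = (t ++ y).take (M - u.length) := by
  have h1 := congrArg (List.take u.length) h
  rw [List.take_take, List.take_take, min_eq_left hu, List.take_append_of_le_length le_rfl,
    List.take_append_of_le_length hux, List.take_length] at h1
  have h2 : x = u ++ x.drop u.length := by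
    conv_lhs => rw [← List.take_append_drop u.length x, ← h1]
  refine ⟨_, h2, ?_⟩
  rw [h2, List.append_assoc, List.take_append, List.take_append (l₁ := u)] at h
  exact List.append_cancel_left h

/-- Comparing truncated lengths of `w` and `w * w` shows that an idempotent class has `|w| ≥ M`;
then `w * z * w` has the same prefix and suffix as `w`. -/
theorem isFiniteLocallyTrivial_quotient [Finite A] [Nonempty A] (M : ℕ) :
    IsFiniteLocallyTrivial (prefixCon A M ⊓ suffixCon A M).Quotient := by
  refine ⟨?_, ⟨((of (Classical.arbitrary A) : FreeSemigroup A) : Con.Quotient _)⟩, ?_⟩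
  · have := (List.finite_length_le A M).to_subtype
    let f : (prefixCon A M ⊓ suffixCon A M).Quotient →
        {l : List A | l.length ≤ M} × {l : List A | l.length ≤ M} :=
      Quotient.lift (fun w : FreeSemigroup A => (⟨w.toList.take M, List.length_take_le _ _⟩,
        ⟨w.toList.reverse.take M, List.length_take_le _ _⟩)) (fun w w' h =>
          Prod.ext (Subtype.ext h.1) (Subtype.ext h.2))
    refine Finite.of_injective f ?_
    rintro ⟨w⟩ ⟨w'⟩ h
    have h₁ : w.toList.take M = w'.toList.take M := congrArg Subtype.val (congrArg Prod.fst h)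
    have h₂ : w.toList.reverse.take M = w'.toList.reverse.take M :=
      congrArg Subtype.val (congrArg Prod.snd h)
    exact (Con.eq _).2 ⟨h₁, h₂⟩
  · rintro ⟨w⟩ he x ⟨⟨z⟩, rfl⟩
    have hM : M ≤ w.toList.length := by
      have h := congrArg List.length ((Con.eq _).1 he.eq).1
      simp only [toList_mul, List.length_take, List.length_append] at h
      have := w.toList_length_pos
      omega
    refine (Con.eq _).2 ⟨?_, ?_⟩
    · change (w * z * w).toList.take M = w.toList.take M
      simp only [toList_mul, List.append_assoc]
      rw [List.take_append_of_le_length hM]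
    · change (w * z * w).toList.reverse.take M = w.toList.reverse.take M
      simp only [toList_mul, List.reverse_append]
      rw [List.take_append_of_le_length (by simpa using hM)]

section Cancel

variable {S : Type u} [Semigroup S] [Finite S] (φ : FreeSemigroup A →ₙ* S) {N M : ℕ}

/-- Short words are equal outright. Long ones share a prefix `p` with `φ p` in the minimal ideal,
and one `z` with `z * φ u * φ p = φ p` cancels `u` before both. -/
theorem map_eq_of_mul_left (hN : ∀ w, N ≤ w.toList.length → InMinimalIdeal (φ w)) (hNpos : 0 < N)
    (hM : N ≤ M) {u v w : FreeSemigroup A} (h : φ (u * v) = φ (u * w))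
    (hvw : v.toList.take M = w.toList.take M) : φ v = φ w := by
  by_cases hv : v.toList.length < N
  · exact congrArg φ (toList_injective (eq_of_take_eq hvw (hv.trans_le hM)))
  have hvw' := congrArg (List.take N) hvw
  rw [List.take_take, List.take_take, min_eq_left hM] at hvw'
  obtain ⟨p, hp⟩ := exists_toList_eq (l := v.toList.take N)
    (by simp [toList_ne_nil, hNpos.ne'])
  obtain ⟨z, hz⟩ := (hN p (by rw [hp, List.length_take]; omega)).exists_eq_mul_left (φ u)
  have key : ∀ v : FreeSemigroup A, v.toList.take N = p.toList → z * φ (u * v) = φ v := by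
    intro v hv
    have h1 : v.toList = p.toList ++ v.toList.drop N := by rw [← hv, List.take_append_drop]
    rcases eq_or_exists_eq_mul_of_toList_eq h1 with rfl | ⟨r, -, rfl⟩
    · rw [map_mul, ← mul_assoc, ← hz]
    · rw [map_mul, map_mul, ← mul_assoc, ← mul_assoc, ← hz]
  rw [← key v hp.symm, h, key w (by rw [← hvw', hp])]

theorem map_eq_of_mul_right (hN : ∀ w, N ≤ w.toList.length → InMinimalIdeal (φ w)) (hNpos : 0 < N)
    (hM : N ≤ M) {u v w : FreeSemigroup A} (h : φ (v * u) = φ (w * u))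
    (hvw : v.toList.reverse.take M = w.toList.reverse.take M) : φ v = φ w := by
  by_cases hv : v.toList.length < N
  · exact congrArg φ (toList_injective (List.reverse_injective
      (eq_of_take_eq hvw (by rw [List.length_reverse]; omega))))
  have hvw' := congrArg (List.take N) hvw
  rw [List.take_take, List.take_take, min_eq_left hM] at hvw'
  obtain ⟨p, hp⟩ := exists_toList_eq (l := (v.toList.reverse.take N).reverse)
    (by simp [toList_ne_nil, hNpos.ne'])
  obtain ⟨z, hz⟩ := (hN p (by
    rw [hp, List.length_reverse, List.length_take, List.length_reverse]
    omega)).exists_eq_mul_right (φ u)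
  have key : ∀ v : FreeSemigroup A, (v.toList.reverse.take N).reverse = p.toList →
      φ (v * u) * z = φ v := by
    intro v hv
    have h1 : v.toList = (v.toList.reverse.drop N).reverse ++ p.toList := by
      rw [← hv, ← List.reverse_append, List.take_append_drop, List.reverse_reverse]
    rcases eq_or_exists_eq_mul_of_toList_eq' h1 with rfl | ⟨r, -, rfl⟩
    · rw [map_mul, ← hz]
    · rw [map_mul, map_mul, mul_assoc, mul_assoc, ← mul_assoc (φ p), ← hz]
  rw [← key v hp.symm, h, key w (by rw [← hvw', hp])]

/-- The bound `2 * N` leaves, after removal of the short `u`, at least the `N` common letters that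
cancellation needs. -/
theorem exists_of_prefix (hN : ∀ w, N ≤ w.toList.length → InMinimalIdeal (φ w)) (hNpos : 0 < N)
    (hM : 2 * N ≤ M) {u v x y : FreeSemigroup A} (h : φ (u * v) = φ (x * y))
    (hp : prefixCon A M (u * v) (x * y)) (hu : u.toList.length < N)
    (hux : u.toList.length ≤ x.toList.length) :
    (φ u = φ x ∧ φ v = φ y) ∨ ∃ t, φ u * t = φ x ∧ φ v = t * φ y := by
  rw [prefixCon_iff, toList_mul, toList_mul] at hp
  obtain ⟨t, hx, hv⟩ := exists_eq_append_of_take_eq hp (by omega) hux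
  rcases eq_or_exists_eq_mul_of_toList_eq hx with rfl | ⟨t, rfl, rfl⟩
  · have ht : t = [] := by simpa using hx
    subst ht
    exact Or.inl ⟨rfl, map_eq_of_mul_left φ hN hNpos (by omega) h hv⟩
  · rw [mul_assoc] at h
    exact Or.inr ⟨φ t, (map_mul _ _ _).symm,
      (map_eq_of_mul_left φ hN hNpos (by omega) h hv).trans (map_mul _ _ _)⟩

theorem exists_of_suffix (hN : ∀ w, N ≤ w.toList.length → InMinimalIdeal (φ w)) (hNpos : 0 < N)
    (hM : 2 * N ≤ M) {u v x y : FreeSemigroup A} (h : φ (u * v) = φ (x * y))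
    (hs : suffixCon A M (u * v) (x * y)) (hv : v.toList.length < N)
    (hvy : v.toList.length ≤ y.toList.length) :
    (φ u = φ x ∧ φ v = φ y) ∨ ∃ t, φ x * t = φ u ∧ φ y = t * φ v := by
  rw [suffixCon_iff, toList_mul, toList_mul, List.reverse_append, List.reverse_append] at hs
  obtain ⟨t, hy, hu⟩ := exists_eq_append_of_take_eq hs (by rw [List.length_reverse]; omega)
    (by simpa using hvy)
  rw [List.length_reverse] at hu
  obtain ⟨t, rfl⟩ := List.reverse_surjective t
  rw [← List.reverse_append] at hy hu
  replace hy := List.reverse_injective hy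
  rcases eq_or_exists_eq_mul_of_toList_eq' hy with rfl | ⟨t, rfl, rfl⟩
  · have ht : t = [] := by simpa using hy
    subst ht
    rw [List.append_nil] at hu
    exact Or.inl ⟨map_eq_of_mul_right φ hN hNpos (by omega) h hu, rfl⟩
  · rw [← mul_assoc] at h
    exact Or.inr ⟨φ t, ((map_eq_of_mul_right φ hN hNpos (by omega) h hu).trans
      (map_mul _ _ _)).symm, map_mul _ _ _⟩

/-- If the shorter left factor or the shorter right factor is below `N`, words are compared;
otherwise all four values lie in the minimal ideal. -/
theorem exists_of_map_mul_eq (hN : ∀ w, N ≤ w.toList.length → InMinimalIdeal (φ w)) (hNpos : 0 < N)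
    (hM : 2 * N ≤ M) {u v x y : FreeSemigroup A} (h : φ (u * v) = φ (x * y))
    (hp : prefixCon A M (u * v) (x * y)) (hs : suffixCon A M (u * v) (x * y)) :
    (φ u = φ x ∧ φ v = φ y) ∨ (∃ t, φ u * t = φ x ∧ φ v = t * φ y) ∨
      ∃ t, φ x * t = φ u ∧ φ y = t * φ v := by
  rcases le_total u.toList.length x.toList.length with hux | hux <;>
  rcases le_total v.toList.length y.toList.length with hvy | hvy
  · by_cases hu : u.toList.length < N
    · exact (exists_of_prefix φ hN hNpos hM h hp hu hux).imp_right Or.inl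
    by_cases hv : v.toList.length < N
    · exact (exists_of_suffix φ hN hNpos hM h hs hv hvy).imp_right Or.inr
    exact Or.inr (Or.inl ((hN v (by omega)).exists_of_mul_eq_mul (hN x (by omega))
      (by simpa only [map_mul] using h)))
  · by_cases hu : u.toList.length < N
    · exact (exists_of_prefix φ hN hNpos hM h hp hu hux).imp_right Or.inl
    by_cases hy : y.toList.length < N
    · exact ((exists_of_suffix φ hN hNpos hM h.symm (Con.symm _ hs) hy hvy).imp_left
        fun h => ⟨h.1.symm, h.2.symm⟩).imp_right Or.inl
    exact Or.inr (Or.inl ((hN v (by omega)).exists_of_mul_eq_mul (hN x (by omega))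
      (by simpa only [map_mul] using h)))
  · by_cases hx : x.toList.length < N
    · exact ((exists_of_prefix φ hN hNpos hM h.symm (Con.symm _ hp) hx hux).imp_left
        fun h => ⟨h.1.symm, h.2.symm⟩).imp_right Or.inr
    by_cases hv : v.toList.length < N
    · exact (exists_of_suffix φ hN hNpos hM h hs hv hvy).imp_right Or.inr
    exact Or.inr (Or.inl ((hN v (by omega)).exists_of_mul_eq_mul (hN x (by omega))
      (by simpa only [map_mul] using h)))
  · by_cases hx : x.toList.length < N
    · exact ((exists_of_prefix φ hN hNpos hM h.symm (Con.symm _ hp) hx hux).imp_left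
        fun h => ⟨h.1.symm, h.2.symm⟩).imp_right Or.inr
    by_cases hy : y.toList.length < N
    · exact ((exists_of_suffix φ hN hNpos hM h.symm (Con.symm _ hs) hy hvy).imp_left
        fun h => ⟨h.1.symm, h.2.symm⟩).imp_right Or.inl
    exact Or.inr (Or.inl ((hN v (by omega)).exists_of_mul_eq_mul (hN x (by omega))
      (by simpa only [map_mul] using h)))

end Cancel

end FreeSemigroup

/-- A pseudovariety of local groups that contains all finite locally trivial semigroups is
equidivisible. -/
theorem Pseudovariety.equidivisible_of_locallyTrivial (V : Pseudovariety.{u})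
    (hV : ∀ (S : Type u) [Semigroup S], V.Mem S → IsFiniteLocalGroup S)
    (hLI : ∀ (S : Type u) [Semigroup S], IsFiniteLocallyTrivial S → V.Mem S) :
    V.Equidivisible := by
  intro A _ _
  refine V.isEquidivisible_freePro fun c u v x y h => ?_
  have := V.finite_of_mem _ c.2
  obtain ⟨N, hNpos, hN⟩ := FreeSemigroup.exists_forall_inMinimalIdeal (hV _ c.2) (conMk c.1)
  -- Representatives chosen at `d` serve for `c` and also reveal prefixes and suffixes of length `2
  -- * N`.
  obtain ⟨d, hdc, hdb⟩ := V.exists_freeCon_le₂ c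
    ⟨_, hLI _ (FreeSemigroup.isFiniteLocallyTrivial_quotient (A := A) (2 * N))⟩
  have rep : ∀ w : V.freePro A, ∃ w' : FreeSemigroup A,
      w.1 d = (w' : d.1.Quotient) ∧ w.1 c = conMk c.1 w' := fun w => by
    obtain ⟨w', hw'⟩ := Quotient.exists_rep (w.1 d)
    exact ⟨w', hw'.symm, by rw [← w.2 d c hdc, ← hw']; rfl⟩
  obtain ⟨u', hu, hu'⟩ := rep u
  obtain ⟨v', hv, hv'⟩ := rep v
  obtain ⟨x', hx, hx'⟩ := rep x
  obtain ⟨y', hy, hy'⟩ := rep y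
  have hd : d.1 (u' * v') (x' * y') := by
    have h1 : u.1 d * v.1 d = x.1 d * y.1 d := congrFun (congrArg Subtype.val h) d
    rw [hu, hv, hx, hy] at h1
    exact (Con.eq _).1 h1
  rw [hu', hv', hx', hy']
  exact FreeSemigroup.exists_of_map_mul_eq (conMk c.1) hN hNpos le_rfl ((Con.eq _).2 (hdc hd))
    (hdb hd).1 (hdb hd).2

/-! ### Necessity: recovering LI from an indecomposable element. -/

namespace FreeSemigroup

variable {A : Type u}

theorem eq_of_or_eq_of_mul (w : FreeSemigroup A) :
    (∃ a, w = of a) ∨ ∃ a r, w = of a * r := by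
  obtain ⟨a, _ | ⟨b, l⟩⟩ := w
  · exact Or.inl ⟨a, rfl⟩
  · exact Or.inr ⟨a, ⟨b, l⟩, rfl⟩

theorem eq_of_or_eq_mul_of (w : FreeSemigroup A) :
    (∃ a, w = of a) ∨ ∃ r a, w = r * of a := by
  obtain ⟨l, a, h⟩ := (List.eq_nil_or_concat' w.toList).resolve_left w.toList_ne_nil
  rcases eq_or_exists_eq_mul_of_toList_eq' (p := of a) h with h | ⟨r, -, h⟩
  · exact Or.inl ⟨a, h⟩
  · exact Or.inr ⟨r, a, h⟩

theorem mul_ne_of (w w' : FreeSemigroup A) (a : A) : w * w' ≠ of a := fun h => by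
  have h1 := congrArg (fun w => w.toList.length) h
  have := w.toList_length_pos
  have := w'.toList_length_pos
  simp only [toList_mul, List.length_append, toList_of, List.length_singleton] at h1
  omega

/-- In a finite locally trivial semigroup, the value of a word is determined by a sufficiently
long prefix and suffix. -/
theorem exists_map_eq_of_prefix_suffix {S : Type u} [Semigroup S] (hS : IsFiniteLocallyTrivial S)
    (φ : FreeSemigroup A →ₙ* S) :
    ∃ M, ∀ w w', prefixCon A M w w' → suffixCon A M w w' → φ w = φ w' := by
  obtain ⟨M, hMpos, hM⟩ := exists_forall_inMinimalIdeal hS.isFiniteLocalGroup φ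
  refine ⟨M, fun w w' hp hs => ?_⟩
  rw [prefixCon_iff] at hp
  rw [suffixCon_iff] at hs
  by_cases hw : w.toList.length < M
  · exact congrArg φ (toList_injective (eq_of_take_eq hp hw))
  have hw' : ¬ w'.toList.length < M := fun hlt => by
    rw [eq_of_take_eq hp.symm hlt] at hlt
    exact hw hlt
  have hkw := hM w (by omega)
  have hkw' := hM w' (by omega)
  -- The common prefix makes `φ w * φ w'` equal to `φ w'`, the common suffix to `φ w`.
  have hleft : φ w * φ w' = φ w' := by
    obtain ⟨p, h⟩ := exists_toList_eq (l := w.toList.take M) (by simp [toList_ne_nil, hMpos.ne'])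
    have hpk := hM p (by rw [h, List.length_take]; omega)
    have hpw : ∀ v : FreeSemigroup A, v.toList.take M = p.toList → φ p * φ v = φ v := by
      intro v hv
      have h1 : v.toList = p.toList ++ v.toList.drop M := by rw [← hv, List.take_append_drop]
      rcases eq_or_exists_eq_mul_of_toList_eq h1 with rfl | ⟨r, -, rfl⟩
      · exact hS.mul_self hpk
      · rw [map_mul, ← mul_assoc, hS.mul_self hpk]
    calc φ w * φ w' = φ p * φ w * φ p * φ w' := by
          rw [hpw w h.symm, mul_assoc, hpw w' (by rw [← hp, h])]
      _ = φ w' := by rw [hS.mul_mul_self hpk, hpw w' (by rw [← hp, h])]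
  have hright : φ w * φ w' = φ w := by
    obtain ⟨p, h⟩ := exists_toList_eq (l := (w.toList.reverse.take M).reverse)
      (by simp [toList_ne_nil, hMpos.ne'])
    have hpk := hM p (by
      rw [h, List.length_reverse, List.length_take, List.length_reverse]
      omega)
    have hpw : ∀ v : FreeSemigroup A, (v.toList.reverse.take M).reverse = p.toList →
        φ v * φ p = φ v := by
      intro v hv
      have h1 : v.toList = (v.toList.reverse.drop M).reverse ++ p.toList := by
        rw [← hv, ← List.reverse_append, List.take_append_drop, List.reverse_reverse]
      rcases eq_or_exists_eq_mul_of_toList_eq' h1 with rfl | ⟨r, -, rfl⟩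
      · exact hS.mul_self hpk
      · rw [map_mul, mul_assoc, hS.mul_self hpk]
    calc φ w * φ w' = φ w * (φ p * φ w' * φ p) := by
          rw [mul_assoc, hpw w' (by rw [← hs, h]), ← mul_assoc, hpw w h.symm]
      _ = φ w := by rw [hS.mul_mul_self hpk, hpw w h.symm]
  exact hright.symm.trans hleft

end FreeSemigroup

/-- Otherwise repeated factoring writes every element as an arbitrarily long product, so the minimal
ideal is everything. -/
theorem IsFiniteLocalGroup.exists_forall_ne_mul {S : Type u} [Semigroup S]
    (hS : IsFiniteLocalGroup S) (hcs : ¬ IsFiniteCompletelySimple S) :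
    ∃ s : S, ∀ a b, s ≠ a * b := by
  have := hS.1
  have := hS.2.1
  by_contra! hcon
  obtain ⟨N, -, hN⟩ := FreeSemigroup.exists_forall_inMinimalIdeal hS
    (FreeSemigroup.lift (id : S → S))
  have hword : ∀ (n : ℕ) (s : S), ∃ w : FreeSemigroup S, n ≤ w.toList.length ∧
      FreeSemigroup.lift (id : S → S) w = s := by
    intro n
    induction n with
    | zero => exact fun s => ⟨FreeSemigroup.of s, Nat.zero_le _, rfl⟩
    | succ n ih =>
      intro s
      obtain ⟨a, b, rfl⟩ := hcon s
      obtain ⟨w, hw, hwa⟩ := ih a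
      refine ⟨w * FreeSemigroup.of b, ?_, by rw [map_mul, hwa]; rfl⟩
      rw [FreeSemigroup.toList_mul, List.length_append, FreeSemigroup.toList_of,
        List.length_singleton]
      omega
  refine hcs (isFiniteCompletelySimple_of_forall_inMinimalIdeal fun k => ?_)
  obtain ⟨w, hw, rfl⟩ := hword N k
  exact hN w hw

namespace Pseudovariety

open FreeSemigroup

variable (V : Pseudovariety.{u}) {A : Type u} [Nonempty A]

/-- Sending `a` to `s` and other letters to `s * s`, only the word `a` has value `s`; one such map
is used for each letter. -/
theorem exists_freeCon_separating_letters [Finite A] {S : Type u} [Semigroup S] (hS : V.Mem S) {s : S}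
    (hs : ∀ a b, s ≠ a * b) :
    ∃ c : V.FreeCon A, ∀ (a : A) (w : FreeSemigroup A), c.1 (of a) w → w = of a := by
  classical
  obtain ⟨c, hc⟩ := V.exists_freeCon_le fun a : A =>
    V.kerFreeCon hS (lift fun b => if b = a then s else s * s)
  refine ⟨c, fun a w h => ?_⟩
  have h1 : lift (fun b => if b = a then s else s * s) (of a) =
    lift (fun b => if b = a then s else s * s) w := hc a h
  rw [lift_of, if_pos rfl] at h1
  rcases w.eq_of_or_eq_of_mul with ⟨b, rfl⟩ | ⟨b, r, rfl⟩
  · rw [lift_of] at h1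
    split_ifs at h1 with hb
    · rw [hb]
    · exact absurd h1 (hs s s)
  · rw [map_mul] at h1
    exact absurd h1 (hs _ _)

variable {V}

/-- If length `M + 1` fails in every quotient, compactness assembles the failures into one equality
`f 0 * f 1 = f 2 * f 3` with letters as first factors. -/
theorem exists_freeCon_le_prefixCon (hV : IsEquidivisible (V.freePro A)) (c₀ : V.FreeCon A)
    (hc₀ : ∀ (a : A) (w : FreeSemigroup A), c₀.1 (of a) w → w = of a) (M : ℕ) :
    ∃ c : V.FreeCon A, c.1 ≤ prefixCon A M := by
  induction M with
  | zero => exact ⟨c₀, fun _ _ _ => rfl⟩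
  | succ M ih =>
    obtain ⟨cM, hcM⟩ := ih
    by_contra hcon
    -- Quantifying over representing words lets the failure survive in coarser quotients.
    let R : ∀ c : V.FreeCon A, (Fin 4 → c.1.Quotient) → Prop := fun c f =>
      f 0 * f 1 = f 2 * f 3 ∧ ∃ (a : A) (r : FreeSemigroup A) (b : A)
        (r' : FreeSemigroup A), f 0 = ((of a : FreeSemigroup A) : c.1.Quotient) ∧
          f 1 = (r : c.1.Quotient) ∧
          f 2 = ((of b : FreeSemigroup A) : c.1.Quotient) ∧
          f 3 = (r' : c.1.Quotient) ∧ ¬ (a = b ∧ prefixCon A M r r')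
    obtain ⟨f, hf⟩ := V.exists_freePro_forall R
      (fun c => by
        obtain ⟨d, hdc, hd₀⟩ := V.exists_freeCon_le₂ c c₀
        obtain ⟨w, w', hww', hne⟩ : ∃ w w', d.1 w w' ∧ ¬ prefixCon A (M + 1) w w' := by
          by_contra! hall
          exact hcon ⟨d, fun w w' h => hall w w' h⟩
        rcases w.eq_of_or_eq_of_mul with ⟨a, rfl⟩ | ⟨a, r, rfl⟩
        · rw [hc₀ a w' (hd₀ hww')] at hne
          exact absurd (Con.refl _ _) hne
        rcases w'.eq_of_or_eq_of_mul with ⟨b, rfl⟩ | ⟨b, r', rfl⟩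
        · exact absurd (hc₀ b _ (hd₀ (Con.symm _ hww'))) (mul_ne_of _ _ _)
        refine ⟨![(of a : FreeSemigroup A), r, (of b : FreeSemigroup A), r'],
          (Con.eq _).2 (hdc hww'), a, r, b, r', rfl, rfl, rfl, rfl, ?_⟩
        rintro ⟨rfl, h⟩
        refine hne ?_
        rw [prefixCon_iff] at h ⊢
        simp [h])
      (by
        rintro c d h f ⟨h1, a, r, b, r', h2, h3, h4, h5, h6⟩
        refine ⟨?_, a, r, b, r', ?_, ?_, ?_, ?_, h6⟩
        · rw [← map_mul, h1, map_mul]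
        · exact congrArg (conTransition h) h2
        · exact congrArg (conTransition h) h3
        · exact congrArg (conTransition h) h4
        · exact congrArg (conTransition h) h5)
    -- At `e` letters are indecomposable, which excludes both `t`; equal factors contradict the
    -- failure, since `e` also sees prefixes of length `M`.
    obtain ⟨e, he₀, heM⟩ := V.exists_freeCon_le₂ c₀ cM
    obtain ⟨-, a, r, b, r', h0, h1, h2, h3, hne⟩ := hf e
    beta_reduce at h0 h1 h2 h3
    rcases hV (f 0) (f 1) (f 2) (f 3) (Subtype.ext (funext fun c => (hf c).1)) with
      ⟨h, h'⟩ | ⟨t, h, -⟩ | ⟨t, h, -⟩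
    · rw [h, h2] at h0
      rw [h', h3] at h1
      have hab := hc₀ b _ (he₀ ((Con.eq _).1 h0))
      exact hne ⟨congrArg FreeSemigroup.head hab, Con.symm _ (hcM (heM ((Con.eq _).1 h1)))⟩
    · obtain ⟨w, hw⟩ := Quotient.exists_rep (t.1 e)
      rw [← h] at h2
      change (f 0).1 e * t.1 e = _ at h2
      rw [h0, ← hw] at h2
      exact mul_ne_of _ _ _ (hc₀ b (of a * w) (he₀ (Con.symm _ ((Con.eq _).1 h2))))
    · obtain ⟨w, hw⟩ := Quotient.exists_rep (t.1 e)
      rw [← h] at h0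
      change (f 2).1 e * t.1 e = _ at h0
      rw [h2, ← hw] at h0
      exact mul_ne_of _ _ _ (hc₀ a (of b * w) (he₀ (Con.symm _ ((Con.eq _).1 h0))))

/-- Mirror image of the preceding argument, stripping last letters. -/
theorem exists_freeCon_le_suffixCon (hV : IsEquidivisible (V.freePro A)) (c₀ : V.FreeCon A)
    (hc₀ : ∀ (a : A) (w : FreeSemigroup A), c₀.1 (of a) w → w = of a) (M : ℕ) :
    ∃ c : V.FreeCon A, c.1 ≤ suffixCon A M := by
  induction M with
  | zero => exact ⟨c₀, fun _ _ _ => rfl⟩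
  | succ M ih =>
    obtain ⟨cM, hcM⟩ := ih
    by_contra hcon
    let R : ∀ c : V.FreeCon A, (Fin 4 → c.1.Quotient) → Prop := fun c f =>
      f 0 * f 1 = f 2 * f 3 ∧ ∃ (r : FreeSemigroup A) (a : A) (r' : FreeSemigroup A)
        (b : A), f 0 = (r : c.1.Quotient) ∧
          f 1 = ((of a : FreeSemigroup A) : c.1.Quotient) ∧
          f 2 = (r' : c.1.Quotient) ∧
          f 3 = ((of b : FreeSemigroup A) : c.1.Quotient) ∧ ¬ (a = b ∧ suffixCon A M r r')
    obtain ⟨f, hf⟩ := V.exists_freePro_forall R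
      (fun c => by
        obtain ⟨d, hdc, hd₀⟩ := V.exists_freeCon_le₂ c c₀
        obtain ⟨w, w', hww', hne⟩ : ∃ w w', d.1 w w' ∧ ¬ suffixCon A (M + 1) w w' := by
          by_contra! hall
          exact hcon ⟨d, fun w w' h => hall w w' h⟩
        rcases w.eq_of_or_eq_mul_of with ⟨a, rfl⟩ | ⟨r, a, rfl⟩
        · rw [hc₀ a w' (hd₀ hww')] at hne
          exact absurd (Con.refl _ _) hne
        rcases w'.eq_of_or_eq_mul_of with ⟨b, rfl⟩ | ⟨r', b, rfl⟩
        · exact absurd (hc₀ b _ (hd₀ (Con.symm _ hww'))) (mul_ne_of _ _ _)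
        refine ⟨![r, (of a : FreeSemigroup A), r', (of b : FreeSemigroup A)],
          (Con.eq _).2 (hdc hww'), r, a, r', b, rfl, rfl, rfl, rfl, ?_⟩
        rintro ⟨rfl, h⟩
        refine hne ?_
        rw [suffixCon_iff] at h ⊢
        simp [h])
      (by
        rintro c d h f ⟨h1, r, a, r', b, h2, h3, h4, h5, h6⟩
        refine ⟨?_, r, a, r', b, ?_, ?_, ?_, ?_, h6⟩
        · rw [← map_mul, h1, map_mul]
        · exact congrArg (conTransition h) h2
        · exact congrArg (conTransition h) h3
        · exact congrArg (conTransition h) h4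
        · exact congrArg (conTransition h) h5)
    obtain ⟨e, he₀, heM⟩ := V.exists_freeCon_le₂ c₀ cM
    obtain ⟨-, r, a, r', b, h0, h1, h2, h3, hne⟩ := hf e
    beta_reduce at h0 h1 h2 h3
    rcases hV (f 0) (f 1) (f 2) (f 3) (Subtype.ext (funext fun c => (hf c).1)) with
      ⟨h, h'⟩ | ⟨t, -, h⟩ | ⟨t, -, h⟩
    · rw [h, h2] at h0
      rw [h', h3] at h1
      have hab := hc₀ b _ (he₀ ((Con.eq _).1 h1))
      exact hne ⟨congrArg FreeSemigroup.head hab, Con.symm _ (hcM (heM ((Con.eq _).1 h0)))⟩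
    · obtain ⟨w, hw⟩ := Quotient.exists_rep (t.1 e)
      rw [h] at h1
      change t.1 e * (f 3).1 e = _ at h1
      rw [h3, ← hw] at h1
      exact mul_ne_of _ _ _ (hc₀ a (w * of b) (he₀ (Con.symm _ ((Con.eq _).1 h1))))
    · obtain ⟨w, hw⟩ := Quotient.exists_rep (t.1 e)
      rw [h] at h3
      change t.1 e * (f 1).1 e = _ at h3
      rw [h1, ← hw] at h3
      exact mul_ne_of _ _ _ (hc₀ b (w * of a) (he₀ (Con.symm _ ((Con.eq _).1 h3))))

/-- An equidivisible pseudovariety containing a semigroup with an indecomposable element contains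
all finite locally trivial semigroups. -/
theorem Equidivisible.mem_of_locallyTrivial (hV : V.Equidivisible) {T : Type u} [Semigroup T]
    (hT : V.Mem T) {s : T} (hs : ∀ a b, s ≠ a * b) (S : Type u) [Semigroup S]
    (hS : IsFiniteLocallyTrivial S) : V.Mem S := by
  have := hS.1
  have := hS.2.1
  -- `S` is its own alphabet, so evaluation of words is onto.
  obtain ⟨c₀, hc₀⟩ := V.exists_freeCon_separating_letters (A := S) hT hs
  obtain ⟨M, hM⟩ := exists_map_eq_of_prefix_suffix hS (lift (id : S → S))
  obtain ⟨c, hc⟩ := exists_freeCon_le_prefixCon (hV S) c₀ hc₀ M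
  obtain ⟨d, hd⟩ := exists_freeCon_le_suffixCon (hV S) c₀ hc₀ M
  obtain ⟨e, hec, hed⟩ := V.exists_freeCon_le₂ c d
  exact V.image_mem _ _ (conLift e.1 (lift (id : S → S))
    fun w w' h => hM w w' (hc (hec h)) (hd (hed h)))
    (fun x => ⟨((of x : FreeSemigroup S) : Con.Quotient _), rfl⟩) e.2

end Pseudovariety

theorem theoremt (V : Pseudovariety.{u})
    (hV : ∀ (S : Type u) [Semigroup S], V.Mem S → IsFiniteLocalGroup S) :
    V.Equidivisible ↔
      (∀ (S : Type u) [Semigroup S], V.Mem S → IsFiniteCompletelySimple S) ∨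
      (∀ (S : Type u) [Semigroup S], IsFiniteLocallyTrivial S → V.Mem S) := by
  constructor
  · intro hE
    by_contra hcon
    rw [not_or] at hcon
    obtain ⟨hcs, hli⟩ := hcon
    push Not at hcs
    obtain ⟨T, _, hT, hTcs⟩ := hcs
    obtain ⟨s, hs⟩ := (hV T hT).exists_forall_ne_mul hTcs
    exact hli fun S _ hS => hE.mem_of_locallyTrivial hT hs S hS
  · rintro (h | h)
    · exact V.equidivisible_of_completelySimple h
    · exact V.equidivisible_of_locallyTrivial hV h
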